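/- Let $\Gamma$ be a discrete abelian group with compact dual group $G$, and regard each $\gamma\in\Gamma$ as a character of $G$. A set $E\subseteq\Gamma$ is called a Sidon set if for every bounded $\varphi:E\to\mathbb{C}$ there is a regular complex Borel measure $\mu$ on $G$ with $\widehat{\mu}(\gamma)=\int_G\gamma\,d\mu=\varphi(\gamma)$ for all $\gamma\in E$. For an integer $n\ge 2$ let $\kappa_n(E)$ be the infimum of the $\epsilon\ge 0$ such that for every function $\varphi$ from $E$ to the $n$-th roots of unity there is $x\in G$ with $|\varphi(\gamma)-\gamma(x)|<\epsilon$ for all $\gamma\in E$. Let $\alpha_n(E)$ be the infimum of the $\epsilon\ge 0$ such that for every $\varphi:E\to\{2\pi j/n: j=0,\dots,n-1\}$ there is $x\in G$ with $|\varphi(\gamma)-\arg\gamma(x)|\le\epsilon$ for all $\gamma\in E$, where the distance between angles is taken modulo $2\pi$. Let $n>1$ be an integer. 1. The coset $1+n\mathbb{Z}$ is not a Sidon subset of $\mathbb{Z}$, but $\alpha_n(1+n\mathbb{Z})=\pi-\pi/n$ and, equivalently, $\kappa_n(1+n\mathbb{Z})=|1-e^{i\pi(1-1/n)}|$. 2.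 Consequently the sufficient condition "$\kappa_n(E)<|1-e^{i\pi(1-1/n)}|$ implies that $E$ is Sidon" (in angular form: "$\alpha_n(E)<\pi-\pi/n$ implies that $E$ is Sidon") is sharp, already for subsets of $\mathbb{Z}$: if $c$ is a real number such that every $E\subseteq\mathbb{Z}$ with $\kappa_n(E)<c$ is Sidon, then $c\le|1-e^{i\pi(1-1/n)}|$; if $c$ is a real number such that every $E\subseteq\mathbb{Z}$ with $\alpha_n(E)<c$ is Sidon, then $c\le\pi-\pi/n$; and in neither form can the strict inequality in the condition be replaced by $\le$. 3. If $n$ is odd, then $\alpha_n(E)\le\pi-\pi/n$ for every subset $E$ of every discrete abelian group $\Gamma$. -/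

import Mathlib

open MeasureTheory

noncomputable section

/-!
Throughout, `Γ` is a discrete abelian group (written multiplicatively), `G = PontryaginDual Γ` is
its compact dual group, and `γ ∈ Γ` is regarded as the character `x ↦ x γ` of `G`.
-/

/-- The dual group carries its Borel σ-algebra. -/
instance instMeasurableSpaceDual (Γ : Type*) [Monoid Γ] [TopologicalSpace Γ] :
    MeasurableSpace (PontryaginDual Γ) :=
  borel _

instance instBorelSpaceDual (Γ : Type*) [Monoid Γ] [TopologicalSpace Γ] :
    BorelSpace (PontryaginDual Γ) :=
  ⟨rfl⟩

/-- The Fourier transform `γ ↦ ∫_G γ(x) dμ(x)` of a complex measure `μ` on `G`; with this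
normalisation the transform of the point mass at `x` is `γ ↦ γ(x)`. -/
def measureFourier {Γ : Type*} [CommGroup Γ] [TopologicalSpace Γ]
    (μ : ComplexMeasure (PontryaginDual Γ)) (γ : Γ) : ℂ :=
  VectorMeasure.integral μ (fun x : PontryaginDual Γ => (x γ : ℂ)) (ContinuousLinearMap.mul ℝ ℂ)

/-- `E ⊆ Γ` is a Sidon set: every bounded function on `E` is the restriction to `E` of the Fourier
transform of a (regular complex Borel) measure on `G`. -/
def IsSidonSet {Γ : Type*} [CommGroup Γ] [TopologicalSpace Γ] (E : Set Γ) : Prop :=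
  ∀ φ : E → ℂ, (∃ C : ℝ, ∀ γ : E, ‖φ γ‖ ≤ C) →
    ∃ μ : ComplexMeasure (PontryaginDual Γ), (VectorMeasure.variation μ).Regular ∧
      ∀ γ : E, measureFourier μ (γ : Γ) = φ γ

/-- The set of `n`-th roots of unity in the circle. -/
def circleRoots (n : ℕ) : Set Circle := {z | z ^ n = 1}

/-- `E` is `(ε, n)`-Kronecker. -/
def IsKronecker {Γ : Type*} [CommGroup Γ] [TopologicalSpace Γ] (n : ℕ) (ε : ℝ) (E : Set Γ) :
    Prop :=
  ∀ φ : E → circleRoots n, ∃ x : PontryaginDual Γ,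
    ∀ γ : E, ‖((φ γ : Circle) : ℂ) - (x (γ : Γ) : ℂ)‖ < ε

/-- `κ_n(E)`: the infimum of the `ε ≥ 0` such that `E` is `(ε, n)`-Kronecker. -/
def kroneckerConst {Γ : Type*} [CommGroup Γ] [TopologicalSpace Γ] (n : ℕ) (E : Set Γ) : ℝ :=
  sInf {ε : ℝ | 0 ≤ ε ∧ IsKronecker n ε E}

/-- The angles `2πj/n`, `j = 0, …, n - 1`. -/
def rootAngles (n : ℕ) : Set ℝ := {θ | ∃ j : ℕ, j < n ∧ θ = 2 * Real.pi * j / n}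

/-- The argument of `z` in `[0, 2π)`. -/
def circleArg (z : Circle) : ℝ := toIcoMod Real.two_pi_pos 0 (Complex.arg (z : ℂ))

/-- The distance `|s - t|` understood modulo `2π`, that is `min_m |s - t - 2πm| ∈ [0, π]`. -/
def angleDist (s t : ℝ) : ℝ := ‖((s - t : ℝ) : AddCircle (2 * Real.pi))‖

/-- `E` is weak `(ε, n)`-angular Kronecker. -/
def IsWeakAngularKronecker {Γ : Type*} [CommGroup Γ] [TopologicalSpace Γ] (n : ℕ) (ε : ℝ)
    (E : Set Γ) : Prop :=
  ∀ φ : E → rootAngles n, ∃ x : PontryaginDual Γ,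
    ∀ γ : E, angleDist (φ γ : ℝ) (circleArg (x (γ : Γ))) ≤ ε

/-- `α_n(E)`: the infimum of the `ε ≥ 0` such that `E` is weak `(ε, n)`-angular Kronecker. -/
def angularKroneckerConst {Γ : Type*} [CommGroup Γ] [TopologicalSpace Γ] (n : ℕ) (E : Set Γ) : ℝ :=
  sInf {ε : ℝ | 0 ≤ ε ∧ IsWeakAngularKronecker n ε E}

/-- The coset `1 + nℤ` in the discrete group `ℤ`. (Mathlib writes the additive group `ℤ`
multiplicatively as `Multiplicative ℤ`.) -/
def onePlusMultiples (n : ℕ) : Set (Multiplicative ℤ) :=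
  {γ | ∃ k : ℤ, γ = Multiplicative.ofAdd (1 + (n : ℤ) * k)}

/-- The bound `|1 - e^{iπ(1 - 1/n)}|`. -/
def sidonThreshold (n : ℕ) : ℝ :=
  ‖1 - Complex.exp (Complex.I * (Real.pi * (1 - 1 / (n : ℝ)) : ℝ))‖

end

/-! ### Chords and angles -/

/-! Upper bound: some character keeps every value on the coset at least π/n in angle from the
antipode of every n-th root of unity. For odd n the trivial character does this on any set, since -1
is not an n-th root; for even n take the character of `ℤ` at e^{iπ/n}, whose values on 1 + nℤ lie
midway between roots (`norm_pi_mul_div_le`).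

Lower bound: each point of the circle has a root at distance at least the threshold
(`exists_root_far`), so one character serves at most (q - 1)^N of the q^N patterns on N elements of
the coset. Characters of `ℤ` form a circle, and on 1, ..., 1 + n(N - 1) it is replaced, up to a
small error, by a grid of O(N) points. So q^N ≤ O(N)(q - 1)^N, which fails for large N. The angular
bound follows because chord length increases with angle.

Not Sidon: a measure whose transform is 1 on the positive and 0 on the negative part of the coset
would integrate `averageDifference` to 1 for all N > 0, but these functions are bounded and tend to
0 pointwise. -/

theorem norm_coe_exp_sub_coe_exp (s t : ℝ) :
    ‖(Circle.exp s : ℂ) - (Circle.exp t : ℂ)‖ =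
      2 * Real.sin (‖((s - t : ℝ) : AddCircle (2 * Real.pi))‖ / 2) := by
  have h0 : ‖(Circle.exp s : ℂ) - (Circle.exp t : ℂ)‖ = ‖(Circle.exp (s - t) : ℂ) - 1‖ := by
    have : (Circle.exp s : ℂ) - (Circle.exp t : ℂ)
        = (Circle.exp t : ℂ) * ((Circle.exp (s - t) : ℂ) - 1) := by
      rw [mul_sub, ← Circle.coe_mul, ← Circle.exp_add]
      simp
    rw [this, norm_mul]
    simp
  -- Passing to the representative in [-π, π] makes the sine of the half angle carry the sign of the
  -- angle.
  set r : ℤ := round ((2 * Real.pi)⁻¹ * (s - t)) with hr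
  have h1 : Circle.exp (s - t) = Circle.exp (s - t - r * (2 * Real.pi)) :=
    Circle.exp_eq_exp.2 ⟨r, by ring⟩
  have h2 : ‖((s - t : ℝ) : AddCircle (2 * Real.pi))‖ = |s - t - r * (2 * Real.pi)| :=
    AddCircle.norm_eq _
  have h3 : |s - t - r * (2 * Real.pi)| ≤ Real.pi := by
    rw [← h2]
    refine (AddCircle.norm_le_half_period _ Real.two_pi_pos.ne').trans_eq ?_
    rw [abs_of_pos Real.two_pi_pos]
    ring
  rw [h0, h1, h2, Circle.coe_exp, mul_comm, Complex.norm_exp_I_mul_ofReal_sub_one, norm_mul,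
    Real.norm_eq_abs, Real.norm_eq_abs, abs_two]
  congr 1
  rcases abs_cases (s - t - r * (2 * Real.pi)) with ⟨h, h'⟩ | ⟨h, h'⟩
  · rw [h] at h3 ⊢
    exact abs_of_nonneg (Real.sin_nonneg_of_nonneg_of_le_pi (by linarith) (by linarith))
  · rw [h] at h3 ⊢
    rw [neg_div, Real.sin_neg]
    exact abs_of_nonpos (Real.sin_nonpos_of_nonpos_of_neg_pi_le (by linarith) (by linarith))

theorem two_mul_sin_half_le {a b : ℝ} (ha : 0 ≤ a) (hab : a ≤ b) (hb : b ≤ Real.pi) :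
    2 * Real.sin (a / 2) ≤ 2 * Real.sin (b / 2) := by
  have := Real.sin_le_sin_of_le_of_le_pi_div_two (x := a / 2) (y := b / 2)
    (by linarith [Real.pi_pos]) (by linarith) (by linarith)
  linarith

theorem two_mul_sin_half_lt {a b : ℝ} (ha : 0 ≤ a) (hab : a < b) (hb : b ≤ Real.pi) :
    2 * Real.sin (a / 2) < 2 * Real.sin (b / 2) := by
  have := Real.sin_lt_sin_of_lt_of_le_pi_div_two (x := a / 2) (y := b / 2)
    (by linarith [Real.pi_pos]) (by linarith) (by linarith)
  linarith

theorem pi_sub_pi_div_nonneg {n : ℕ} (hn : 1 < n) : 0 ≤ Real.pi - Real.pi / n := by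
  have h : (1 : ℝ) ≤ n := by exact_mod_cast hn.le
  linarith [div_le_self Real.pi_pos.le h]

theorem pi_sub_pi_div_le (n : ℕ) : Real.pi - Real.pi / n ≤ Real.pi := by
  have : 0 ≤ Real.pi / n := by positivity
  linarith

theorem sidonThreshold_eq {n : ℕ} (hn : 1 < n) :
    sidonThreshold n = 2 * Real.sin ((Real.pi - Real.pi / n) / 2) := by
  have h := pi_sub_pi_div_nonneg hn
  rw [sidonThreshold, norm_sub_rev, Complex.norm_exp_I_mul_ofReal_sub_one,
    show Real.pi * (1 - 1 / (n : ℝ)) = Real.pi - Real.pi / n by ring, Real.norm_eq_abs,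
    abs_of_nonneg]
  have := Real.sin_nonneg_of_nonneg_of_le_pi (x := (Real.pi - Real.pi / n) / 2) (by linarith)
    (by linarith [pi_sub_pi_div_le n, Real.pi_pos])
  linarith

theorem sidonThreshold_nonneg (n : ℕ) : 0 ≤ sidonThreshold n := norm_nonneg _

theorem exp_circleArg (z : Circle) : Circle.exp (circleArg z) = z := by
  conv_rhs => rw [← Circle.exp_arg z]
  refine Circle.exp_eq_exp.2 ⟨-toIcoDiv Real.two_pi_pos 0 (Complex.arg (z : ℂ)), ?_⟩
  have h := toIcoMod_add_toIcoDiv_zsmul Real.two_pi_pos 0 (Complex.arg (z : ℂ))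
  rw [zsmul_eq_mul] at h
  rw [circleArg]
  push_cast
  linarith

/-- An integer multiple `a * (π / n)` with `a + n` odd stays at distance `π / n` from `π`. -/
theorem norm_pi_mul_div_le {n : ℕ} (hn : 1 < n) {a : ℤ} (ha : Odd (a + n)) :
    ‖((Real.pi * a / n : ℝ) : AddCircle (2 * Real.pi))‖ ≤ Real.pi - Real.pi / n := by
  have hn0 : (0 : ℝ) < n := by exact_mod_cast (by omega : 0 < n)
  have hle : ‖((Real.pi * a / n : ℝ) : AddCircle (2 * Real.pi))‖ ≤ Real.pi := by
    refine (AddCircle.norm_le_half_period _ Real.two_pi_pos.ne').trans_eq ?_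
    rw [abs_of_pos Real.two_pi_pos]
    ring
  rw [AddCircle.norm_eq] at hle ⊢
  set r : ℤ := round ((2 * Real.pi)⁻¹ * (Real.pi * a / n))
  have h1 : |Real.pi * a / n - r * (2 * Real.pi)| = Real.pi * (|a - 2 * r * n| : ℤ) / n := by
    rw [show Real.pi * a / n - r * (2 * Real.pi) = Real.pi * ((a - 2 * r * n : ℤ) : ℝ) / n by
      push_cast; field_simp, abs_div, abs_mul, abs_of_pos Real.pi_pos, abs_of_pos hn0]
    push_cast
    rfl
  rw [h1] at hle ⊢
  have h2 : |a - 2 * r * n| ≤ n := by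
    rw [div_le_iff₀ hn0] at hle
    exact_mod_cast le_of_mul_le_mul_left hle Real.pi_pos
  -- Equality would give a and n the same parity; excluding it improves the integer bound n to n -
  -- 1.
  have h3 : |a - 2 * r * n| ≠ n := by
    intro h
    obtain ⟨c, hc⟩ := ha
    rcases abs_cases (a - 2 * r * n) with ⟨h', -⟩ | ⟨h', -⟩
    · have : a = n + 2 * (r * n) := by linarith
      omega
    · have : a = -n + 2 * (r * n) := by linarith
      omega
  have h4 : ((|a - 2 * r * n| : ℤ) : ℝ) ≤ n - 1 := by
    have : |a - 2 * r * n| ≤ (n : ℤ) - 1 := by omega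
    exact_mod_cast this
  rw [div_le_iff₀ hn0, sub_mul, div_mul_cancel₀ _ hn0.ne']
  nlinarith [Real.pi_pos]

theorem angleDist_rootAngle_le {n : ℕ} (hn : 1 < n) (j : ℕ) {m : ℤ} (hm : Odd (m + n)) (z : Circle)
    (hz : z = Circle.exp (Real.pi * m / n)) :
    angleDist (2 * Real.pi * j / n) (circleArg z) ≤ Real.pi - Real.pi / n := by
  have hn0 : (n : ℝ) ≠ 0 := by exact_mod_cast (by omega : n ≠ 0)
  obtain ⟨k, hk⟩ := Circle.exp_eq_exp.1 ((exp_circleArg z).trans hz)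
  rw [angleDist, hk, show 2 * Real.pi * j / n - (Real.pi * m / n + k * (2 * Real.pi))
    = Real.pi * ((2 * j - m - 2 * k * n : ℤ) : ℝ) / n by push_cast; field_simp; ring]
  refine norm_pi_mul_div_le hn ?_
  obtain ⟨c, hc⟩ := hm
  exact ⟨j - k * n + n - c - 1, by linear_combination -hc⟩

/-! ### Kronecker constants -/

theorem exists_rootAngle {n : ℕ} (hn : 1 < n) (w : circleRoots n) :
    ∃ θ : rootAngles n, Circle.exp θ = w := by
  have hw : (w : Circle) ^ n = 1 := w.2
  have : NeZero n := ⟨by omega⟩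
  have hprim := Complex.isPrimitiveRoot_exp n (by omega)
  obtain ⟨j, hj, h⟩ := hprim.eq_pow_of_pow_eq_one (ξ := (w : ℂ))
    (by rw [← Circle.coe_pow, hw, Circle.coe_one])
  refine ⟨⟨2 * Real.pi * j / n, j, hj, rfl⟩, ?_⟩
  ext
  rw [← h, Circle.coe_exp, ← Complex.exp_nat_mul]
  congr 1
  push_cast
  ring

/-- Chord length is monotone in the angle up to π. The slack δ is needed because the angular
condition is closed and the chordal one strict. -/
theorem IsWeakAngularKronecker.isKronecker {Γ : Type*} [CommGroup Γ] [TopologicalSpace Γ] {n : ℕ}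
    (hn : 1 < n) {E : Set Γ} {ε δ : ℝ} (h : IsWeakAngularKronecker n ε E) (hε : ε ≤ Real.pi)
    (hδ : 2 * Real.sin (ε / 2) < δ) : IsKronecker n δ E := by
  intro φ
  choose θ hθ using fun γ => exists_rootAngle hn (φ γ)
  obtain ⟨x, hx⟩ := h θ
  refine ⟨x, fun γ => lt_of_le_of_lt ?_ hδ⟩
  rw [← hθ, ← exp_circleArg (x γ), norm_coe_exp_sub_coe_exp]
  exact two_mul_sin_half_le (norm_nonneg _) (hx γ) hε

theorem kroneckerConst_le {Γ : Type*} [CommGroup Γ] [TopologicalSpace Γ] {n : ℕ} {E : Set Γ} {c : ℝ}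
    (hc : 0 ≤ c) (h : ∀ δ, c < δ → IsKronecker n δ E) : kroneckerConst n E ≤ c :=
  le_of_forall_gt_imp_ge_of_dense fun δ hδ =>
    csInf_le ⟨0, fun _ h => h.1⟩ ⟨hc.trans hδ.le, h δ hδ⟩

theorem angularKroneckerConst_le {Γ : Type*} [CommGroup Γ] [TopologicalSpace Γ] {n : ℕ} {E : Set Γ}
    {c : ℝ} (hc : 0 ≤ c) (h : IsWeakAngularKronecker n c E) : angularKroneckerConst n E ≤ c :=
  csInf_le ⟨0, fun _ h => h.1⟩ ⟨hc, h⟩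

theorem isWeakAngularKronecker_of_odd {Γ : Type*} [CommGroup Γ] [TopologicalSpace Γ] {n : ℕ}
    (hn : 1 < n) (hodd : Odd n) (E : Set Γ) :
    IsWeakAngularKronecker n (Real.pi - Real.pi / n) E := by
  refine fun φ => ⟨1, fun γ => ?_⟩
  obtain ⟨j, -, hj⟩ := (φ γ).2
  rw [hj]
  exact angleDist_rootAngle_le hn j (m := 0) (by simpa using hodd) _ (by simp)

/-! ### Characters of `ℤ` -/

/-- The character `m ↦ z ^ m` of `ℤ`. -/
noncomputable def intCharacter (z : Circle) : PontryaginDual (Multiplicative ℤ) :=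
  ContinuousMonoidHom.mk (zpowersHom Circle z) continuous_of_discreteTopology

theorem intCharacter_ofAdd (z : Circle) (m : ℤ) :
    intCharacter z (Multiplicative.ofAdd m) = z ^ m := rfl

theorem character_ofAdd (x : PontryaginDual (Multiplicative ℤ)) (m : ℤ) :
    x (Multiplicative.ofAdd m) = x (Multiplicative.ofAdd 1) ^ m := by
  rw [← map_zpow, ← ofAdd_zsmul]
  simp

theorem isWeakAngularKronecker_onePlusMultiples {n : ℕ} (hn : 1 < n) :
    IsWeakAngularKronecker n (Real.pi - Real.pi / n) (onePlusMultiples n) := by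
  rcases Nat.even_or_odd n with heven | hodd
  -- For even n, 1 + nk is odd, so the value at 1 + nk is an odd multiple of π/n, whatever φ is.
  · refine fun φ => ⟨intCharacter (Circle.exp (Real.pi / n)), ?_⟩
    rintro ⟨_, k, rfl⟩
    obtain ⟨j, -, hj⟩ := (φ ⟨_, k, rfl⟩).2
    rw [hj]
    refine angleDist_rootAngle_le hn j (m := 1 + n * k) ?_ _ ?_
    · obtain ⟨c, hc⟩ := heven
      exact ⟨c * k + c, by rw [hc]; push_cast; ring⟩
    · rw [intCharacter_ofAdd, ← Circle.exp_zsmul]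
      congr 1
      rw [zsmul_eq_mul]
      ring
  · exact isWeakAngularKronecker_of_odd hn hodd _

/-! ### The lower bound for the Kronecker constant -/

/-- The root nearest to -z is within angle π/n of it, hence at angle at least π - π/n from z. -/
theorem exists_root_far {n : ℕ} (hn : 1 < n) (z : Circle) :
    ∃ w : circleRoots n, sidonThreshold n ≤ ‖((w : Circle) : ℂ) - (z : ℂ)‖ := by
  have hn0 : (0 : ℝ) < n := by exact_mod_cast (by omega : 0 < n)
  obtain ⟨s, rfl⟩ := Circle.exp_surjective z
  set j : ℤ := round (n * (s + Real.pi) / (2 * Real.pi)) with hj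
  refine ⟨⟨Circle.exp (2 * Real.pi * j / n), ?_⟩, ?_⟩
  · change _ ^ n = 1
    rw [← Circle.exp_nsmul, nsmul_eq_mul, mul_div_cancel₀ _ hn0.ne']
    exact Circle.exp_two_pi_mul_int j
  rw [sidonThreshold_eq hn, norm_coe_exp_sub_coe_exp]
  refine two_mul_sin_half_le (pi_sub_pi_div_nonneg hn) ?_ ?_
  · have h1 : |s + Real.pi - 2 * Real.pi * j / n| ≤ Real.pi / n := by
      have h := abs_sub_round (n * (s + Real.pi) / (2 * Real.pi))
      rw [← hj] at h
      have h2 : s + Real.pi - 2 * Real.pi * j / n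
          = (2 * Real.pi / n) * (n * (s + Real.pi) / (2 * Real.pi) - j) := by
        field_simp
      rw [h2, abs_mul, abs_of_pos (by positivity)]
      calc _ ≤ 2 * Real.pi / n * (1 / 2) := by gcongr
        _ = _ := by ring
    have h2 : ‖((s + Real.pi - 2 * Real.pi * j / n : ℝ) : AddCircle (2 * Real.pi))‖
        ≤ Real.pi / n := by
      refine le_trans ?_ h1
      exact QuotientAddGroup.norm_mk_le_norm
    have h3 : ‖((Real.pi : ℝ) : AddCircle (2 * Real.pi))‖ = Real.pi := by
      have := AddCircle.norm_half_period_eq (2 * Real.pi)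
      rwa [abs_of_pos Real.two_pi_pos, mul_div_cancel_left₀ _ two_ne_zero] at this
    have h4 := norm_add_le ((s + Real.pi - 2 * Real.pi * j / n : ℝ) : AddCircle (2 * Real.pi))
      ((2 * Real.pi * j / n - s : ℝ) : AddCircle (2 * Real.pi))
    rw [← AddCircle.coe_add, show s + Real.pi - 2 * Real.pi * j / n + (2 * Real.pi * j / n - s)
      = Real.pi by ring, h3] at h4
    linarith
  · refine (AddCircle.norm_le_half_period _ Real.two_pi_pos.ne').trans_eq ?_
    rw [abs_of_pos Real.two_pi_pos]
    ring

theorem circleRoots_finite {n : ℕ} (hn : 1 < n) : (circleRoots n).Finite := by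
  refine Set.Finite.of_finite_image (f := fun z : Circle => (z : ℂ)) ?_ Circle.coe_injective.injOn
  refine (Polynomial.nthRootsFinset n (1 : ℂ)).finite_toSet.subset ?_
  rintro _ ⟨z, hz, rfl⟩
  have hz : z ^ n = 1 := hz
  simp [Polynomial.mem_nthRootsFinset (by omega : 0 < n), ← Circle.coe_pow, hz]

/-- A chord is no longer than its arc, and the m-th power multiplies arcs by m. -/
theorem norm_exp_pow_sub_exp_pow_le (s t : ℝ) (m : ℕ) :
    ‖((Circle.exp s ^ m : Circle) : ℂ) - ((Circle.exp t ^ m : Circle) : ℂ)‖ ≤ m * |s - t| := by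
  rw [← Circle.exp_nsmul, ← Circle.exp_nsmul, norm_coe_exp_sub_coe_exp]
  have h1 : ‖((m • s - m • t : ℝ) : AddCircle (2 * Real.pi))‖ ≤ |m • s - m • t| :=
    QuotientAddGroup.norm_mk_le_norm
  have h2 := Real.sin_le (x := ‖((m • s - m • t : ℝ) : AddCircle (2 * Real.pi))‖ / 2)
    (by positivity)
  rw [← smul_sub, nsmul_eq_mul, abs_mul, Nat.abs_cast] at h1
  rw [← smul_sub, nsmul_eq_mul] at h2 ⊢
  linarith

/-- The `M`-th roots of unity approximate the circle to within `2π / M`. -/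
theorem exists_root_near {M : ℕ} (hM : 0 < M) (z : Circle) :
    ∃ i < M, ∀ m : ℕ, ‖((Circle.exp (2 * Real.pi * i / M) ^ m : Circle) : ℂ) - ((z ^ m : Circle) : ℂ)‖
      ≤ m * (2 * Real.pi / M) := by
  have hM0 : (0 : ℝ) < M := by exact_mod_cast hM
  have hpi := Real.two_pi_pos
  obtain ⟨h0, h1⟩ := toIcoMod_mem_Ico Real.two_pi_pos 0 (Complex.arg (z : ℂ))
  change 0 ≤ circleArg z at h0
  change circleArg z < 0 + 2 * Real.pi at h1
  rw [zero_add] at h1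
  -- Rounding down, rather than to the nearest integer, keeps the index below M.
  refine ⟨⌊M * circleArg z / (2 * Real.pi)⌋₊, ?_, fun m => ?_⟩
  · rw [Nat.floor_lt (by positivity), div_lt_iff₀ hpi]
    gcongr
  · have hle := norm_exp_pow_sub_exp_pow_le (2 * Real.pi * ⌊M * circleArg z / (2 * Real.pi)⌋₊ / M)
      (circleArg z) m
    rw [exp_circleArg] at hle
    refine hle.trans ?_
    gcongr
    have ha := Nat.floor_le (a := M * circleArg z / (2 * Real.pi)) (by positivity)
    have hb := Nat.lt_floor_add_one (M * circleArg z / (2 * Real.pi))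
    set i := ⌊M * circleArg z / (2 * Real.pi)⌋₊
    have h2 : 2 * Real.pi * i / M - circleArg z
        = (2 * Real.pi / M) * (i - M * circleArg z / (2 * Real.pi)) := by
      field_simp
    rw [h2, abs_mul, abs_of_pos (by positivity)]
    refine mul_le_of_le_one_right (by positivity) (abs_le.2 ⟨by linarith, by linarith⟩)

/-- If every assignment of roots of unity to `1, 1 + n, …, 1 + n (N - 1)` is followed, up to
`sidonThreshold n`, by one of `M` points of the circle, then `q ^ N ≤ M (q - 1) ^ N` where `q` is
the number of roots. -/
theorem card_pow_le {n : ℕ} (hn : 1 < n) [Fintype (circleRoots n)] {N M : ℕ} (y : ℕ → Circle)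
    (h : ∀ φ : Fin N → circleRoots n, ∃ i < M, ∀ k : Fin N,
      ‖((φ k : Circle) : ℂ) - ((y i ^ (1 + n * (k : ℕ)) : Circle) : ℂ)‖ < sidonThreshold n) :
    Fintype.card (circleRoots n) ^ N ≤ M * (Fintype.card (circleRoots n) - 1) ^ N := by
  classical
  -- The patterns served by the i-th point form a box whose sides each miss at least one root.
  let S : ℕ → Fin N → Finset (circleRoots n) := fun i k =>
    Finset.univ.filter fun w =>
      ‖((w : Circle) : ℂ) - ((y i ^ (1 + n * (k : ℕ)) : Circle) : ℂ)‖ < sidonThreshold n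
  have hS : ∀ i k, (S i k).card ≤ Fintype.card (circleRoots n) - 1 := by
    intro i k
    obtain ⟨w, hw⟩ := exists_root_far hn (y i ^ (1 + n * (k : ℕ)))
    refine Nat.le_sub_one_of_lt (Finset.card_lt_univ_of_notMem (x := w) ?_)
    exact fun hmem => (Finset.mem_filter.1 hmem).2.not_ge hw
  have hcover : (Finset.univ : Finset (Fin N → circleRoots n)) ⊆
      (Finset.range M).biUnion fun i => Fintype.piFinset (S i) := by
    intro φ _
    obtain ⟨i, hi, hφ⟩ := h φ
    exact Finset.mem_biUnion.2 ⟨i, Finset.mem_range.2 hi,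
      Fintype.mem_piFinset.2 fun k => Finset.mem_filter.2 ⟨Finset.mem_univ _, hφ k⟩⟩
  calc Fintype.card (circleRoots n) ^ N
      = (Finset.univ : Finset (Fin N → circleRoots n)).card := by simp
    _ ≤ _ := Finset.card_le_card hcover
    _ ≤ (Finset.range M).card * (Fintype.card (circleRoots n) - 1) ^ N := by
        refine Finset.card_biUnion_le_card_mul _ _ _ fun i _ => ?_
        rw [Fintype.card_piFinset]
        exact (Finset.prod_le_pow_card _ _ _ fun k _ => hS i k).trans_eq (by simp)
    _ = _ := by simp

/-- A linear factor loses to the geometric decay of ((q - 1)/q)^N. -/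
theorem exists_mul_pow_lt_pow {q : ℕ} (hq : 0 < q) (A B : ℝ) :
    ∃ N : ℕ, (A * N + B) * ((q - 1 : ℕ) : ℝ) ^ N < (q : ℝ) ^ N := by
  have hq0 : (0 : ℝ) < q := by exact_mod_cast hq
  have hr0 : (0 : ℝ) ≤ ((q - 1 : ℕ) : ℝ) / q := by positivity
  have hr1 : ((q - 1 : ℕ) : ℝ) / q < 1 := by
    rw [div_lt_one hq0]
    exact_mod_cast Nat.sub_lt hq one_pos
  have h1 := (tendsto_self_mul_const_pow_of_lt_one hr0 hr1).const_mul A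
  have h2 := (tendsto_pow_atTop_nhds_zero_of_lt_one hr0 hr1).const_mul B
  have h3 := h1.add h2
  rw [mul_zero, mul_zero, add_zero] at h3
  obtain ⟨N, hN⟩ := (h3.eventually_lt_const one_pos).exists
  refine ⟨N, ?_⟩
  rw [div_pow] at hN
  have hqN : (0 : ℝ) < (q : ℝ) ^ N := by positivity
  have : (A * N + B) * ((q - 1 : ℕ) : ℝ) ^ N / (q : ℝ) ^ N < 1 := by
    refine lt_of_eq_of_lt ?_ hN
    ring
  rwa [div_lt_one hqN] at this

theorem not_isKronecker_onePlusMultiples {n : ℕ} (hn : 1 < n) {ε : ℝ} (hε : ε < sidonThreshold n) :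
    ¬ IsKronecker n ε (onePlusMultiples n) := by
  intro h
  have : Fintype (circleRoots n) := (circleRoots_finite hn).fintype
  have hq : 0 < Fintype.card (circleRoots n) :=
    Fintype.card_pos_iff.2 ⟨⟨1, one_pow n⟩⟩
  set δ := sidonThreshold n - ε
  have hδ : 0 < δ := sub_pos.2 hε
  have hpi := Real.two_pi_pos
  obtain ⟨N, hN⟩ := exists_mul_pow_lt_pow hq (2 * Real.pi * n / δ) (2 * Real.pi / δ + 1)
  -- Fine enough that the grid error is at most δ for exponents up to 1 + nN, yet only linear in N.
  set M : ℕ := ⌈2 * Real.pi * (1 + n * N) / δ⌉₊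
  have hMpos : 0 < M := Nat.ceil_pos.2 (by positivity)
  have hM0 : (0 : ℝ) < M := by exact_mod_cast hMpos
  have hMge : 2 * Real.pi * (1 + n * N) / δ ≤ M := Nat.le_ceil _
  have hMle : (M : ℝ) ≤ 2 * Real.pi * n / δ * N + (2 * Real.pi / δ + 1) := by
    refine (Nat.ceil_lt_add_one (by positivity)).le.trans_eq ?_
    ring
  have key := card_pow_le hn (N := N) (M := M) (fun i => Circle.exp (2 * Real.pi * i / M)) ?_
  · have key' : (Fintype.card (circleRoots n) : ℝ) ^ N
        ≤ M * ((Fintype.card (circleRoots n) - 1 : ℕ) : ℝ) ^ N := by exact_mod_cast key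
    have := mul_le_mul_of_nonneg_right hMle
      (by positivity : (0 : ℝ) ≤ ((Fintype.card (circleRoots n) - 1 : ℕ) : ℝ) ^ N)
    linarith
  · intro φ
    have hone : (1 : Circle) ^ n = 1 := one_pow n
    -- An extension of φ to the whole coset; `toNat` collapses negative k to 0, which is harmless
    -- since only 0 ≤ k < N is used.
    let ψ : onePlusMultiples n → circleRoots n := fun γ =>
      if hk : (((Multiplicative.toAdd (γ : Multiplicative ℤ) - 1) / n).toNat) < N then φ ⟨_, hk⟩
      else ⟨1, hone⟩
    have hψ : ∀ k : Fin N, ψ ⟨Multiplicative.ofAdd (1 + (n : ℤ) * (k : ℕ)), _, rfl⟩ = φ k := by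
      intro k
      have hk : ((Multiplicative.toAdd (Multiplicative.ofAdd (1 + (n : ℤ) * (k : ℕ))) - 1) / n).toNat
          = k := by
        rw [toAdd_ofAdd, add_sub_cancel_left, Int.mul_ediv_cancel_left _ (by omega), Int.toNat_natCast]
      simp only [ψ, hk, k.2, dif_pos]
    obtain ⟨x, hx⟩ := h ψ
    obtain ⟨i, hi, hnear⟩ := exists_root_near hMpos (x (Multiplicative.ofAdd 1))
    refine ⟨i, hi, fun k => ?_⟩
    have h1 := hx ⟨Multiplicative.ofAdd (1 + (n : ℤ) * (k : ℕ)), _, rfl⟩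
    rw [hψ] at h1
    have h2 := hnear (1 + n * (k : ℕ))
    have hz : x (Multiplicative.ofAdd (1 + (n : ℤ) * (k : ℕ)))
        = x (Multiplicative.ofAdd 1) ^ (1 + n * (k : ℕ)) := by
      rw [character_ofAdd, ← zpow_natCast]
      push_cast
      rfl
    rw [hz] at h1
    have h3 : ((1 + n * (k : ℕ) : ℕ) : ℝ) * (2 * Real.pi / M) ≤ δ := by
      have hk : ((1 + n * (k : ℕ) : ℕ) : ℝ) ≤ 1 + n * N := by
        have : (1 + n * (k : ℕ) : ℕ) ≤ 1 + n * N := by gcongr; exact k.2.le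
        exact_mod_cast this
      rw [div_le_iff₀ hδ] at hMge
      rw [mul_div_assoc', div_le_iff₀ hM0]
      nlinarith
    have h4 := norm_sub_le_norm_sub_add_norm_sub ((φ k : Circle) : ℂ)
      ((x (Multiplicative.ofAdd 1) ^ (1 + n * (k : ℕ)) : Circle) : ℂ)
      ((Circle.exp (2 * Real.pi * i / M) ^ (1 + n * (k : ℕ)) : Circle) : ℂ)
    rw [norm_sub_rev] at h2
    linarith

theorem kroneckerConst_onePlusMultiples {n : ℕ} (hn : 1 < n) :
    kroneckerConst n (onePlusMultiples n) = sidonThreshold n := by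
  have hupper : ∀ δ, sidonThreshold n < δ → IsKronecker n δ (onePlusMultiples n) := fun δ hδ =>
    (isWeakAngularKronecker_onePlusMultiples hn).isKronecker hn (pi_sub_pi_div_le n)
      (by rwa [← sidonThreshold_eq hn])
  refine le_antisymm (kroneckerConst_le (sidonThreshold_nonneg n) hupper) (le_csInf ?_ ?_)
  · exact ⟨_, (sidonThreshold_nonneg n).trans (lt_add_one _).le, hupper _ (lt_add_one _)⟩
  · rintro ε ⟨-, hε⟩
    by_contra! hlt
    exact not_isKronecker_onePlusMultiples hn hlt hε

theorem angularKroneckerConst_onePlusMultiples {n : ℕ} (hn : 1 < n) :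
    angularKroneckerConst n (onePlusMultiples n) = Real.pi - Real.pi / n := by
  have hupper := isWeakAngularKronecker_onePlusMultiples hn
  have h0 := pi_sub_pi_div_nonneg hn
  refine le_antisymm (angularKroneckerConst_le h0 hupper) (le_csInf ⟨_, h0, hupper⟩ ?_)
  rintro ε ⟨hε0, hε⟩
  by_contra! hlt
  -- A smaller angular constant would give a chordal one below the threshold.
  have hlt' := two_mul_sin_half_lt hε0 hlt (pi_sub_pi_div_le n)
  rw [← sidonThreshold_eq hn] at hlt'
  obtain ⟨δ, h1, h2⟩ := exists_between hlt'
  exact not_isKronecker_onePlusMultiples hn h2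
    (hε.isKronecker hn (hlt.le.trans (pi_sub_pi_div_le n)) h1)

/-! ### The coset is not a Sidon set -/

theorem norm_geom_sum_le_of_norm_eq_one {u : ℂ} (hu : ‖u‖ = 1) (hne : u ≠ 1) (N : ℕ) :
    ‖∑ k ∈ Finset.range N, u ^ k‖ ≤ 2 / ‖u - 1‖ := by
  rw [geom_sum_eq hne, norm_div]
  gcongr
  refine (norm_sub_le _ _).trans_eq ?_
  rw [norm_pow, hu]
  norm_num

/-- If u = 1 the terms cancel exactly, which is why the difference of two averages is taken;
otherwise both geometric sums stay bounded in N. -/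
theorem tendsto_average_pow_sub_inv_pow (z u : Circle) :
    Filter.Tendsto (fun N : ℕ => ((N : ℝ)⁻¹ : ℝ) • ∑ k ∈ Finset.range N,
      (((z * u ^ k : Circle) : ℂ) - ((z * u⁻¹ ^ (k + 1) : Circle) : ℂ)))
      Filter.atTop (nhds 0) := by
  rcases eq_or_ne u 1 with rfl | hu
  · simp
  have hu' : (u : ℂ) ≠ 1 := fun h => hu (Circle.ext h)
  have hv' : ((u⁻¹ : Circle) : ℂ) ≠ 1 := fun h => hu (inv_eq_one.1 (Circle.ext h))
  set C : ℝ := 2 / ‖(u : ℂ) - 1‖ + 2 / ‖((u⁻¹ : Circle) : ℂ) - 1‖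
  have hC : Filter.Tendsto (fun N : ℕ => (N : ℝ)⁻¹ * C) Filter.atTop (nhds 0) := by
    simpa using (tendsto_inv_atTop_nhds_zero_nat (𝕜 := ℝ)).mul_const C
  refine squeeze_zero_norm (fun N => ?_) hC
  rw [norm_smul, Real.norm_of_nonneg (by positivity)]
  gcongr
  have h1 : ∑ k ∈ Finset.range N,
      (((z * u ^ k : Circle) : ℂ) - ((z * u⁻¹ ^ (k + 1) : Circle) : ℂ))
      = (z : ℂ) * ∑ k ∈ Finset.range N, (u : ℂ) ^ k
        - (z : ℂ) * (u⁻¹ : Circle) * ∑ k ∈ Finset.range N, ((u⁻¹ : Circle) : ℂ) ^ k := by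
    rw [Finset.mul_sum, Finset.mul_sum, ← Finset.sum_sub_distrib]
    refine Finset.sum_congr rfl fun k _ => ?_
    simp only [Circle.coe_mul, Circle.coe_pow]
    ring
  rw [h1]
  refine (norm_sub_le _ _).trans ?_
  rw [norm_mul, norm_mul, norm_mul, Circle.norm_coe, Circle.norm_coe, one_mul, one_mul, one_mul]
  exact add_le_add (norm_geom_sum_le_of_norm_eq_one (Circle.norm_coe _) hu' N)
    (norm_geom_sum_le_of_norm_eq_one (Circle.norm_coe _) hv' N)

theorem continuous_character_eval {Γ : Type*} [CommGroup Γ] [TopologicalSpace Γ] (γ : Γ) :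
    Continuous fun x : PontryaginDual Γ => (x γ : ℂ) :=
  continuous_subtype_val.comp
    ((ContinuousEvalConst.continuous_eval_const (F := Γ →ₜ* Circle) γ))

/-- The average of the `N` characters `1, 1 + n, …` minus that of the `N` characters
`1 - n, 1 - 2 n, …`. -/
noncomputable def averageDifference (n N : ℕ) (x : PontryaginDual (Multiplicative ℤ)) : ℂ :=
  (N : ℝ)⁻¹ • ∑ k ∈ Finset.range N,
    ((x (Multiplicative.ofAdd (1 + (n : ℤ) * (k : ℤ))) : ℂ)
      - (x (Multiplicative.ofAdd (1 + (n : ℤ) * (-(k + 1 : ℤ)))) : ℂ))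

theorem continuous_averageDifference (n N : ℕ) : Continuous (averageDifference n N) :=
  (continuous_finsetSum (Finset.range N) fun k _ =>
    (continuous_character_eval (Multiplicative.ofAdd (1 + (n : ℤ) * (k : ℤ)))).sub
      (continuous_character_eval
        (Multiplicative.ofAdd (1 + (n : ℤ) * (-(k + 1 : ℤ)))))).const_smul (N : ℝ)⁻¹

theorem norm_averageDifference_le (n N : ℕ) (x : PontryaginDual (Multiplicative ℤ)) :
    ‖averageDifference n N x‖ ≤ 2 := by
  rw [averageDifference, norm_smul, Real.norm_of_nonneg (by positivity)]
  rcases Nat.eq_zero_or_pos N with rfl | hN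
  · simp
  · have hN0 : (0 : ℝ) < N := by exact_mod_cast hN
    rw [inv_mul_le_iff₀ hN0]
    refine (norm_sum_le_of_le (n := fun _ => 2) _ fun k _ => (norm_sub_le _ _).trans_eq ?_).trans_eq
      (by simp)
    rw [Circle.norm_coe, Circle.norm_coe]
    norm_num

theorem tendsto_averageDifference (n : ℕ) (x : PontryaginDual (Multiplicative ℤ)) :
    Filter.Tendsto (fun N => averageDifference n N x) Filter.atTop (nhds 0) := by
  refine (tendsto_average_pow_sub_inv_pow (x (Multiplicative.ofAdd 1))
    (x (Multiplicative.ofAdd 1) ^ n)).congr fun N => ?_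
  rw [averageDifference]
  congr 1
  refine Finset.sum_congr rfl fun k _ => ?_
  have h1 : x (Multiplicative.ofAdd (1 + (n : ℤ) * (k : ℤ)))
      = x (Multiplicative.ofAdd 1) * (x (Multiplicative.ofAdd 1) ^ n) ^ k := by
    rw [character_ofAdd, zpow_add, zpow_one, zpow_mul, zpow_natCast, zpow_natCast]
  have h2 : x (Multiplicative.ofAdd (1 + (n : ℤ) * (-(k + 1 : ℤ))))
      = x (Multiplicative.ofAdd 1) * (x (Multiplicative.ofAdd 1) ^ n)⁻¹ ^ (k + 1) := by
    rw [character_ofAdd, zpow_add, zpow_one, zpow_mul, zpow_natCast, zpow_neg, inv_pow]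
    norm_cast
  rw [h1, h2]

theorem integrable_character {Γ : Type*} [CommGroup Γ] [TopologicalSpace Γ]
    (μ : ComplexMeasure (PontryaginDual Γ)) [IsFiniteMeasure (VectorMeasure.variation μ)] (γ : Γ) :
    VectorMeasure.Integrable μ fun x : PontryaginDual Γ => (x γ : ℂ) :=
  Integrable.of_bound (continuous_character_eval γ).aestronglyMeasurable 1
    (Filter.Eventually.of_forall fun _ => (Circle.norm_coe _).le)

theorem integral_averageDifference (μ : ComplexMeasure (PontryaginDual (Multiplicative ℤ)))
    [IsFiniteMeasure (VectorMeasure.variation μ)] (n N : ℕ) :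
    VectorMeasure.integral μ (averageDifference n N) (ContinuousLinearMap.mul ℝ ℂ) =
      (N : ℝ)⁻¹ • ∑ k ∈ Finset.range N,
        (measureFourier μ (Multiplicative.ofAdd (1 + (n : ℤ) * (k : ℤ)))
          - measureFourier μ (Multiplicative.ofAdd (1 + (n : ℤ) * (-(k + 1 : ℤ))))) := by
  unfold averageDifference
  rw [VectorMeasure.integral_fun_smul, VectorMeasure.integral_finsetSum]
  · congr 1
    exact Finset.sum_congr rfl fun k _ =>
      VectorMeasure.integral_fun_sub (integrable_character μ _) (integrable_character μ _)
  · exact fun k _ => (integrable_character μ _).sub (integrable_character μ _)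

theorem tendsto_integral_averageDifference
    (μ : ComplexMeasure (PontryaginDual (Multiplicative ℤ)))
    [IsFiniteMeasure (VectorMeasure.variation μ)] (n : ℕ) :
    Filter.Tendsto
      (fun N => VectorMeasure.integral μ (averageDifference n N) (ContinuousLinearMap.mul ℝ ℂ))
      Filter.atTop (nhds 0) := by
  rw [← VectorMeasure.integral_zero (μ := μ) (B := ContinuousLinearMap.mul ℝ ℂ)]
  exact VectorMeasure.tendsto_integral_of_dominated_convergence (fun _ => 2)
    (fun N => (continuous_averageDifference n N).aestronglyMeasurable) (integrable_const _)
    (fun N => Filter.Eventually.of_forall (norm_averageDifference_le n N))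
    (Filter.Eventually.of_forall (tendsto_averageDifference n))

theorem not_isSidonSet_onePlusMultiples {n : ℕ} (hn : 1 < n) :
    ¬ IsSidonSet (onePlusMultiples n) := by
  intro h
  obtain ⟨μ, hreg, hμ⟩ := h
    -- This function separates the two averages: 1 + nk is positive exactly when k ≥ 0, as n > 1.
    (fun γ => if 0 < Multiplicative.toAdd (γ : Multiplicative ℤ) then 1 else 0)
    ⟨1, fun γ => by split_ifs <;> simp⟩
  have hfin : IsFiniteMeasure (VectorMeasure.variation μ) := inferInstance
  have hpos : ∀ k : ℕ, measureFourier μ (Multiplicative.ofAdd (1 + (n : ℤ) * (k : ℤ))) = 1 := by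
    intro k
    refine (hμ ⟨Multiplicative.ofAdd (1 + (n : ℤ) * (k : ℤ)), _, rfl⟩).trans (if_pos ?_)
    simp only [toAdd_ofAdd]
    positivity
  have hneg : ∀ k : ℕ,
      measureFourier μ (Multiplicative.ofAdd (1 + (n : ℤ) * (-(k + 1 : ℤ)))) = 0 := by
    intro k
    refine (hμ ⟨Multiplicative.ofAdd (1 + (n : ℤ) * (-(k + 1 : ℤ))), _, rfl⟩).trans (if_neg ?_)
    simp only [toAdd_ofAdd]
    have : (1 : ℤ) < n := by exact_mod_cast hn
    nlinarith
  have hone : ∀ N : ℕ, 0 < N →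
      VectorMeasure.integral μ (averageDifference n N) (ContinuousLinearMap.mul ℝ ℂ) = 1 := by
    intro N hN
    have hN0 : (N : ℂ) ≠ 0 := by exact_mod_cast hN.ne'
    rw [integral_averageDifference]
    simp only [hpos, hneg]
    simp [hN0]
  refine one_ne_zero (α := ℂ) (tendsto_nhds_unique ?_ (tendsto_integral_averageDifference μ n))
  exact tendsto_const_nhds.congr'
    ((Filter.eventually_gt_atTop 0).mono fun N hN => (hone N hN).symm)

theorem mainTheorem5 (n : ℕ) (hn : 1 < n) :
    (¬ IsSidonSet (onePlusMultiples n) ∧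
      angularKroneckerConst n (onePlusMultiples n) = Real.pi - Real.pi / n ∧
      kroneckerConst n (onePlusMultiples n) = sidonThreshold n) ∧
    ((∀ c : ℝ, (∀ E : Set (Multiplicative ℤ), kroneckerConst n E < c → IsSidonSet E) →
        c ≤ sidonThreshold n) ∧
      (∀ c : ℝ, (∀ E : Set (Multiplicative ℤ), angularKroneckerConst n E < c → IsSidonSet E) →
        c ≤ Real.pi - Real.pi / n) ∧
      ¬ (∀ E : Set (Multiplicative ℤ), kroneckerConst n E ≤ sidonThreshold n → IsSidonSet E) ∧
      ¬ (∀ E : Set (Multiplicative ℤ), angularKroneckerConst n E ≤ Real.pi - Real.pi / n →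
          IsSidonSet E)) ∧
    (Odd n → ∀ (Γ : Type*) [CommGroup Γ] [TopologicalSpace Γ] [DiscreteTopology Γ] (E : Set Γ),
      angularKroneckerConst n E ≤ Real.pi - Real.pi / n) := by
  have hS := not_isSidonSet_onePlusMultiples hn
  have hα := angularKroneckerConst_onePlusMultiples hn
  have hκ := kroneckerConst_onePlusMultiples hn
  refine ⟨⟨hS, hα, hκ⟩, ⟨fun c hc => ?_, fun c hc => ?_, fun h => hS (h _ hκ.le),
    fun h => hS (h _ hα.le)⟩, fun hodd Γ _ _ _ E => ?_⟩
  · by_contra! hlt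
    exact hS (hc _ (hκ.trans_lt hlt))
  · by_contra! hlt
    exact hS (hc _ (hα.trans_lt hlt))
  · exact angularKroneckerConst_le (pi_sub_pi_div_nonneg hn)
      (isWeakAngularKronecker_of_odd hn hodd E)
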